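/- Let $Q=\{(m,n)\in\mathbb Z^2 \mid m\le n-2\}$. The elements $(m,n)$ of $Q$ are called arcs and are thought of as arcs connecting the non-neighbouring integers $m$ and $n$. Two arcs $(a,b)$ and $(c,d)$ cross if $a<c<b<d$ or $c<a<d<b$. A collection $\mathfrak T\subseteq Q$ of arcs is called non-crossing if no two of its arcs cross, maximal non-crossing if moreover it is not properly contained in another non-crossing collection of arcs, and locally finite if for each integer $n$ only finitely many arcs of the form $(m,n)$ or $(n,p)$ belong to $\mathfrak T$. An $\mathrm{SL}_2$-tiling of $Q$ with values in a commutative ring $R$ is a map $r:Q\to R$ such that $$r(i,j)\,r(i+1,j+1)-r(i,j+1)\,r(i+1,j)=1$$ for all $i,j$ such that $(i,j),(i,j+1),(i+1,j),(i+1,j+1)$ all lie in $Q$, and such that, along the edge of $Q$, $$r(i,i+2)\,r(i+1,i+3)-r(i,i+3)=1\qquad\text{for all } i\in\mathbb Z.$$ Theorem. Let $\mathfrak T$ be a locally finite maximal non-crossing collection of arcs. Then there is an $\mathrm{SL}_2$-tiling $r:Q\to\{1,2,3,\ldots\}\subset\mathbb Z$ which satisfies $r(\mathfrak t)=1$ for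 each $\mathfrak t\in\mathfrak T$. -/

import Mathlib

/-- The half plane `Q = {(m, n) | m ≤ n - 2}` in `ℤ × ℤ`. Its elements are also viewed as the arcs
`(m, n)` connecting non-neighbouring integers `m < n`. -/
def halfPlane : Set (ℤ × ℤ) := {p | p.1 ≤ p.2 - 2}

/-- Two arcs `(a, b)` and `(c, d)` cross if `a < c < b < d` or `c < a < d < b`; arcs that only
share an end point do not cross. -/
def ArcsCross (s t : halfPlane) : Prop :=
  (s.1.1 < t.1.1 ∧ t.1.1 < s.1.2 ∧ s.1.2 < t.1.2) ∨
    (t.1.1 < s.1.1 ∧ s.1.1 < t.1.2 ∧ t.1.2 < s.1.2)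

/-- A collection of pairwise non-crossing arcs. -/
def IsNonCrossing (T : Set halfPlane) : Prop :=
  ∀ s ∈ T, ∀ t ∈ T, ¬ ArcsCross s t

/-- A collection of non-crossing arcs which is maximal, with respect to inclusion, among all
collections of non-crossing arcs. -/
def IsMaximalNonCrossing (T : Set halfPlane) : Prop :=
  Maximal IsNonCrossing T

/-- A collection of arcs is locally finite if each integer `n` is an end point of only finitely
many of its arcs. -/
def IsLocallyFiniteArcs (T : Set halfPlane) : Prop :=
  ∀ n : ℤ, {t ∈ T | t.1.1 = n ∨ t.1.2 = n}.Finite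

theorem mem_halfPlane {m n : ℤ} : (m, n) ∈ halfPlane ↔ m ≤ n - 2 := Iff.rfl

/-- An `SL₂`-tiling of the half plane with values in a commutative ring `R`: each matrix of
adjacent values has determinant `1` when its four entries lie over the half plane, and along the
edge the same holds with the missing entry replaced by `1`. -/
structure IsSL2Tiling {R : Type*} [CommRing R] (r : halfPlane → R) : Prop where
  det_eq_one : ∀ (i j : ℤ) (h₁ : (i, j) ∈ halfPlane) (h₂ : (i, j + 1) ∈ halfPlane)
    (h₃ : (i + 1, j) ∈ halfPlane) (h₄ : (i + 1, j + 1) ∈ halfPlane),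
    Matrix.det !![r ⟨(i, j), h₁⟩, r ⟨(i, j + 1), h₂⟩;
                  r ⟨(i + 1, j), h₃⟩, r ⟨(i + 1, j + 1), h₄⟩] = 1
  edge_det_eq_one : ∀ i : ℤ,
    Matrix.det !![r ⟨(i, i + 2), mem_halfPlane.2 (by omega)⟩,
                    r ⟨(i, i + 3), mem_halfPlane.2 (by omega)⟩;
                  1, r ⟨(i + 1, i + 3), mem_halfPlane.2 (by omega)⟩] = 1

/-! A maximal non-crossing collection triangulates the polygon below each of its arcs. Attach
vectors of `ℤ × ℤ` to the vertices as in the Farey construction: the apex of a triangle receives the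
sum of the vectors at the ends of its base. Determinants along arcs and edges are then `1`, all
others are positive (`pairDet_across`), and the tiling relations are instances of the Ptolemy
relation. Local finiteness places every finite interval below some arc (`exists_joins_cover`). The
determinants below an arc depend only on `T` (`IsUnimodularOn.pairDet_unique`), so the local
solutions agree and define the tiling on the whole half plane. -/

/-- `Joins T m n` for a collection `T` of arcs: either `m` and `n = m + 1` are neighbours, or
`(m, n)` is an arc of `T`. -/
def Joins (T : Set halfPlane) (m n : ℤ) : Prop :=
  n = m + 1 ∨ ∃ h : (m, n) ∈ halfPlane, (⟨(m, n), h⟩ : halfPlane) ∈ T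

/-! ### Combinatorics of maximal non-crossing collections -/

section Joins

variable {T : Set halfPlane} {a b c d : ℤ}

theorem joins_succ (T : Set halfPlane) (a : ℤ) : Joins T a (a + 1) := Or.inl rfl

theorem Joins.lt (h : Joins T a b) : a < b := by
  rcases h with h | ⟨h, -⟩
  · omega
  · rw [mem_halfPlane] at h; omega

theorem Joins.not_cross (hT : IsNonCrossing T) (h₁ : Joins T a b) (h₂ : Joins T c d)
    (hac : a < c) (hcb : c < b) (hbd : b < d) : False := by
  rcases h₁ with h₁ | ⟨_, h₁⟩
  · omega
  rcases h₂ with h₂ | ⟨_, h₂⟩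
  · omega
  exact hT _ h₁ _ h₂ (Or.inl ⟨hac, hcb, hbd⟩)

/-- By maximality, `a < b` are joined as soon as `(a, b)` crosses nothing. -/
theorem joins_of_forall (hT : IsMaximalNonCrossing T) (hab : a < b)
    (h₁ : ∀ c d, Joins T c d → a < c → c < b → b < d → False)
    (h₂ : ∀ c d, Joins T c d → c < a → a < d → d < b → False) : Joins T a b := by
  by_cases hb : b = a + 1
  · exact Or.inl hb
  have hmem : (a, b) ∈ halfPlane := mem_halfPlane.2 (by omega)
  refine Or.inr ⟨hmem, ?_⟩
  have key : ∀ t ∈ T, ¬ ArcsCross ⟨(a, b), hmem⟩ t ∧ ¬ ArcsCross t ⟨(a, b), hmem⟩ := by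
    rintro ⟨⟨c, d⟩, hcd⟩ ht
    have hj : Joins T c d := Or.inr ⟨hcd, ht⟩
    have h₁ := h₁ c d hj
    have h₂ := h₂ c d hj
    simp only [ArcsCross]
    constructor <;> rintro (⟨x, y, z⟩ | ⟨x, y, z⟩)
    exacts [h₁ x y z, h₂ x y z, h₂ x y z, h₁ x y z]
  have hins : IsNonCrossing (insert ⟨(a, b), hmem⟩ T) := by
    rintro s (rfl | hs) t (rfl | ht)
    · simp [ArcsCross]
    · exact (key t ht).1
    · exact (key s hs).2
    · exact hT.prop s hs t ht
  exact hT.le_of_ge hins (Set.subset_insert _ _) (Set.mem_insert _ _)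

/-- The triangle below an arc. -/
theorem Joins.exists_apex (hT : IsMaximalNonCrossing T) (h : Joins T a b) (hab : a + 1 < b) :
    ∃ k, a < k ∧ k < b ∧ Joins T a k ∧ Joins T k b := by
  -- The apex is the farthest vertex short of `b` joined to `a`: an arc crossing `(k, b)` would
  -- cross `(a, b)` or `(a, k)`, or join `a` to a vertex strictly between `k` and `b`.
  obtain ⟨k, ⟨hak, hkb⟩, hmax⟩ := Int.exists_greatest_of_bdd
    (P := fun k => Joins T a k ∧ k < b) ⟨b, fun z hz => hz.2.le⟩ ⟨a + 1, joins_succ T a, hab⟩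
  refine ⟨k, hak.lt, hkb, hak, joins_of_forall hT hkb ?_ ?_⟩
  · intro c d hcd h₁ h₂ h₃
    exact h.not_cross hT.prop hcd (hak.lt.trans h₁) h₂ h₃
  · intro c d hcd h₁ h₂ h₃
    rcases lt_trichotomy c a with hca | rfl | hca
    · exact hcd.not_cross hT.prop h hca (hak.lt.trans h₂) h₃
    · have := hmax d ⟨hcd, h₃⟩
      omega
    · exact hak.not_cross hT.prop hcd hca h₁ h₂

theorem bddAbove_joins (hfin : IsLocallyFiniteArcs T) (a : ℤ) : BddAbove {b | Joins T a b} := by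
  have h : {b | Joins T a b} ⊆
      insert (a + 1) ((fun t : halfPlane => t.1.2) '' {t ∈ T | t.1.1 = a ∨ t.1.2 = a}) := by
    rintro b (hb | ⟨hm, hb⟩)
    · exact Or.inl hb
    · exact Or.inr ⟨_, ⟨hb, Or.inl rfl⟩, rfl⟩
  exact (((hfin a).image _).insert _).bddAbove.mono h

theorem exists_greatest_joins (hfin : IsLocallyFiniteArcs T) (a : ℤ) :
    ∃ b, Joins T a b ∧ ∀ c, Joins T a c → c ≤ b := by
  obtain ⟨B, hB⟩ := bddAbove_joins hfin a
  exact Int.exists_greatest_of_bdd (P := Joins T a) ⟨B, fun z hz => hB hz⟩ ⟨_, joins_succ T a⟩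

/-- Every integer lies strictly below some arc. -/
theorem exists_joins_over (hT : IsMaximalNonCrossing T) (hfin : IsLocallyFiniteArcs T) (x : ℤ) :
    ∃ c d, Joins T c d ∧ c < x ∧ x < d := by
  by_contra! hx
  -- With nothing above `x`, the longest arc from `x` followed by the longest from its end `p` gives
  -- a pair `(x, q)` that crosses nothing; so `x` is joined to `q > p`, against the choice of `p`.
  obtain ⟨p, hxp, hp⟩ := exists_greatest_joins hfin x
  obtain ⟨q, hpq, hq⟩ := exists_greatest_joins hfin p
  have hxq : Joins T x q := by
    refine joins_of_forall hT (hxp.lt.trans hpq.lt) ?_ ?_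
    · intro c d hcd h₁ h₂ h₃
      rcases lt_trichotomy c p with hcp | rfl | hcp
      · exact hxp.not_cross hT.prop hcd h₁ hcp (hpq.lt.trans h₃)
      · have := hq d hcd
        omega
      · exact hpq.not_cross hT.prop hcd hcp h₂ h₃
    · intro c d hcd h₁ h₂ _
      have := hx c d hcd h₁
      omega
  have := hp q hxq
  have := hpq.lt
  omega

theorem Joins.exists_extend_left (hT : IsMaximalNonCrossing T) (hfin : IsLocallyFiniteArcs T)
    (h : Joins T a b) : ∃ c d, Joins T c d ∧ c < a ∧ b ≤ d := by
  obtain ⟨c, d, hcd, hc, hd⟩ := exists_joins_over hT hfin a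
  exact ⟨c, d, hcd, hc, not_lt.1 fun hdb => hcd.not_cross hT.prop h hc hd hdb⟩

theorem Joins.exists_extend_right (hT : IsMaximalNonCrossing T) (hfin : IsLocallyFiniteArcs T)
    (h : Joins T a b) : ∃ c d, Joins T c d ∧ c ≤ a ∧ b < d := by
  obtain ⟨c, d, hcd, hc, hd⟩ := exists_joins_over hT hfin b
  exact ⟨c, d, hcd, not_lt.1 fun hac => h.not_cross hT.prop hcd hac hc hd, hd⟩

/-- Every finite interval lies below some arc. -/
theorem exists_joins_cover (hT : IsMaximalNonCrossing T) (hfin : IsLocallyFiniteArcs T)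
    (m n : ℤ) : ∃ a b, Joins T a b ∧ a ≤ m ∧ n ≤ b := by
  have key : ∀ N : ℕ, ∃ a b, Joins T a b ∧ a ≤ m - N ∧ m + N ≤ b := by
    intro N
    induction N with
    | zero => exact ⟨m, m + 1, joins_succ T m, by simp, by simp⟩
    | succ N ih =>
      obtain ⟨a, b, h, ha, hb⟩ := ih
      obtain ⟨a', b', h', ha', hb'⟩ := h.exists_extend_left hT hfin
      obtain ⟨c, d, hcd, hc, hd⟩ := h'.exists_extend_right hT hfin
      exact ⟨c, d, hcd, by push_cast; omega, by push_cast; omega⟩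
  obtain ⟨a, b, h, ha, hb⟩ := key (n - m).toNat
  exact ⟨a, b, h, by omega, by omega⟩

end Joins

/-! ### Determinants of vectors below an arc -/

/-- The `2 × 2` determinant of the vectors `v i` and `v j`. -/
def pairDet (v : ℤ → ℤ × ℤ) (i j : ℤ) : ℤ := (v i).1 * (v j).2 - (v i).2 * (v j).1

theorem pairDet_self (v : ℤ → ℤ × ℤ) (i : ℤ) : pairDet v i i = 0 := by
  simp only [pairDet]; ring

/-- The Ptolemy relation. -/
theorem pairDet_mul_pairDet (v : ℤ → ℤ × ℤ) (i j k l : ℤ) :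
    pairDet v i k * pairDet v j l =
      pairDet v i j * pairDet v k l + pairDet v i l * pairDet v j k := by
  simp only [pairDet]; ring

/-- A family of vectors is `T`-unimodular on `[a, b]` if the determinants `pairDet v i j` with
`a ≤ i < j ≤ b` are positive, and equal to `1` whenever `i` and `j` are joined. -/
structure IsUnimodularOn (T : Set halfPlane) (a b : ℤ) (v : ℤ → ℤ × ℤ) : Prop where
  pos : ∀ i j, a ≤ i → i < j → j ≤ b → 0 < pairDet v i j
  eq_one : ∀ i j, a ≤ i → j ≤ b → Joins T i j → pairDet v i j = 1

section Unimodular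

variable {T : Set halfPlane} {a b c d : ℤ} {v w : ℤ → ℤ × ℤ}

theorem IsUnimodularOn.mono (h : IsUnimodularOn T c d v) (hca : c ≤ a) (hbd : b ≤ d) :
    IsUnimodularOn T a b v :=
  ⟨fun i j hi hij hj => h.pos i j (hca.trans hi) hij (hj.trans hbd),
    fun i j hi hj hij => h.eq_one i j (hca.trans hi) (hj.trans hbd) hij⟩

theorem IsUnimodularOn.congr (h : IsUnimodularOn T a b v) (hvw : ∀ i, a ≤ i → i ≤ b → w i = v i) :
    IsUnimodularOn T a b w := by
  have key : ∀ i j, a ≤ i → i < j → j ≤ b → pairDet w i j = pairDet v i j := by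
    intro i j hi hij hj
    simp only [pairDet, hvw i hi (hij.le.trans hj), hvw j (hi.trans hij.le) hj]
  refine ⟨fun i j hi hij hj => ?_, fun i j hi hj hij => ?_⟩
  · rw [key i j hi hij hj]; exact h.pos i j hi hij hj
  · rw [key i j hi hij.lt hj]; exact h.eq_one i j hi hj hij

/-- Across the apex `k` of a triangle `a < k < b`, the determinants are expressed through those on
either side. -/
theorem pairDet_across {i j k : ℤ} (hak : pairDet v a k = 1) (hkb : pairDet v k b = 1)
    (hab : pairDet v a b = 1) : pairDet v i j =
      pairDet v a i * pairDet v k j + (pairDet v j b + pairDet v k j) * pairDet v i k := by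
  -- The first relation leaves the unwanted factor `pairDet v a j`; the second evaluates it as
  -- `pairDet v j b + pairDet v k j`.
  have h₁ := pairDet_mul_pairDet v a i k j
  have h₂ := pairDet_mul_pairDet v a k j b
  rw [hak, one_mul] at h₁
  rw [hkb, hak, hab] at h₂
  rw [h₁]
  linear_combination pairDet v i k * h₂

/-- Unimodular families on adjacent sides of a triangle combine. -/
theorem IsUnimodularOn.triangle {k : ℤ} (hT : IsNonCrossing T) (hak : Joins T a k)
    (hkb : Joins T k b) (h₁ : IsUnimodularOn T a k v) (h₂ : IsUnimodularOn T k b v)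
    (hab : pairDet v a b = 1) : IsUnimodularOn T a b v := by
  refine ⟨fun i j hi hij hj => ?_, fun i j hi hj hij => ?_⟩
  · rcases le_or_gt j k with hjk | hkj
    · exact h₁.pos i j hi hij hjk
    rcases le_or_gt k i with hki | hik
    · exact h₂.pos i j hki hij hj
    rw [pairDet_across (h₁.eq_one a k le_rfl le_rfl hak) (h₂.eq_one k b le_rfl le_rfl hkb) hab]
    have hai : 0 ≤ pairDet v a i := by
      rcases hi.eq_or_lt with rfl | hi
      · exact (pairDet_self v a).ge
      · exact (h₁.pos a i le_rfl hi hik.le).le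
    have hjb : 0 ≤ pairDet v j b := by
      rcases hj.eq_or_lt with rfl | hj
      · exact (pairDet_self v j).ge
      · exact (h₂.pos j b hkj.le hj le_rfl).le
    have hkj' := h₂.pos k j le_rfl hkj hj
    have hik' := h₁.pos i k hi hik le_rfl
    positivity
  · rcases le_or_gt j k with hjk | hkj
    · exact h₁.eq_one i j hi hjk hij
    rcases le_or_gt k i with hki | hik
    · exact h₂.eq_one i j hki hj hij
    rcases hi.eq_or_lt with rfl | hi
    · rcases hj.eq_or_lt with rfl | hj
      · exact hab
      · exact (hij.not_cross hT hkb hik hkj hj).elim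
    · exact (hak.not_cross hT hij hi hik hkj).elim

/-- Prescribing both end vectors lets the induction close: the families on the two sides of the
triangle both take the value `p + q` at the apex, hence glue, and `p`, `p + q` and `p + q`, `q`
again have determinant `1`. -/
theorem exists_isUnimodularOn_aux (hT : IsMaximalNonCrossing T) (N : ℕ) :
    ∀ (a b : ℤ), Joins T a b → b - a ≤ N → ∀ p q : ℤ × ℤ, p.1 * q.2 - p.2 * q.1 = 1 →
      ∃ v, v a = p ∧ v b = q ∧ IsUnimodularOn T a b v := by
  induction N with
  | zero =>
    intro a b h hN
    have := h.lt
    simp at hN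
    omega
  | succ N ih =>
    intro a b h hN p q hpq
    have hlt := h.lt
    by_cases hab : a + 1 < b
    · obtain ⟨k, hak, hkb, jak, jkb⟩ := h.exists_apex hT hab
      push_cast at hN
      obtain ⟨v₁, ha₁, hk₁, h₁⟩ := ih a k jak (by omega) p (p + q)
        (by simp only [Prod.fst_add, Prod.snd_add]; linear_combination hpq)
      obtain ⟨v₂, hk₂, hb₂, h₂⟩ := ih k b jkb (by omega) (p + q) q
        (by simp only [Prod.fst_add, Prod.snd_add]; linear_combination hpq)
      have e₁ : ∀ i, i ≤ k → (if i ≤ k then v₁ i else v₂ i) = v₁ i := fun i hi => if_pos hi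
      have e₂ : ∀ i, k ≤ i → (if i ≤ k then v₁ i else v₂ i) = v₂ i := by
        intro i hi
        rcases hi.eq_or_lt with rfl | hi
        · rw [if_pos le_rfl, hk₁, hk₂]
        · exact if_neg (not_le.2 hi)
      have ea := (e₁ a hak.le).trans ha₁
      have eb := (e₂ b hkb.le).trans hb₂
      refine ⟨fun i => if i ≤ k then v₁ i else v₂ i, ea, eb,
        IsUnimodularOn.triangle hT.prop jak jkb (h₁.congr fun i _ hi => e₁ i hi)
          (h₂.congr fun i hi _ => e₂ i hi) ?_⟩
      simp only [pairDet, ea, eb]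
      exact hpq
    · obtain rfl : b = a + 1 := by omega
      have hv : pairDet (fun i => if i = a then p else q) a (a + 1) = 1 := by
        simpa [pairDet] using hpq
      refine ⟨fun i => if i = a then p else q, by simp, by simp, ?_, ?_⟩
      · intro i j hi hij hj
        obtain rfl : i = a := by omega
        obtain rfl : j = i + 1 := by omega
        rw [hv]; exact one_pos
      · intro i j hi hj hij
        have := hij.lt
        obtain rfl : i = a := by omega
        obtain rfl : j = i + 1 := by omega
        exact hv

theorem Joins.exists_isUnimodularOn (hT : IsMaximalNonCrossing T) (h : Joins T a b) :
    ∃ v, IsUnimodularOn T a b v := by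
  obtain ⟨v, -, -, hv⟩ := exists_isUnimodularOn_aux hT (b - a).toNat a b h
    (Int.self_le_toNat _) (1, 0) (0, 1) (by simp)
  exact ⟨v, hv⟩

/-- The vectors are only determined up to a common change of basis, but the determinants are not
affected: `pairDet_across` reduces those across the apex to those below the two shorter sides. -/
theorem IsUnimodularOn.pairDet_unique_aux (hT : IsMaximalNonCrossing T) (N : ℕ) :
    ∀ a b : ℤ, Joins T a b → b - a ≤ N → IsUnimodularOn T a b v → IsUnimodularOn T a b w →
      ∀ i j, a ≤ i → i ≤ j → j ≤ b → pairDet v i j = pairDet w i j := by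
  induction N with
  | zero =>
    intro a b h hN
    have := h.lt
    simp at hN
    omega
  | succ N ih =>
    intro a b h hN hv hw i j hi hij hj
    rcases hij.eq_or_lt with rfl | hij
    · rw [pairDet_self, pairDet_self]
    by_cases hab : a + 1 < b
    · obtain ⟨k, hak, hkb, jak, jkb⟩ := h.exists_apex hT hab
      push_cast at hN
      have ih₁ := ih a k jak (by omega) (hv.mono le_rfl hkb.le) (hw.mono le_rfl hkb.le)
      have ih₂ := ih k b jkb (by omega) (hv.mono hak.le le_rfl) (hw.mono hak.le le_rfl)
      rcases le_or_gt j k with hjk | hkj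
      · exact ih₁ i j hi hij.le hjk
      rcases le_or_gt k i with hki | hik
      · exact ih₂ i j hki hij.le hj
      rw [pairDet_across (v := v) (hv.eq_one a k le_rfl hkb.le jak)
          (hv.eq_one k b hak.le le_rfl jkb) (hv.eq_one a b le_rfl le_rfl h),
        pairDet_across (v := w) (hw.eq_one a k le_rfl hkb.le jak)
          (hw.eq_one k b hak.le le_rfl jkb) (hw.eq_one a b le_rfl le_rfl h),
        ih₁ a i le_rfl hi hik.le, ih₁ i k hi hik.le le_rfl, ih₂ k j le_rfl hkj.le hj,
        ih₂ j b hkj.le hj le_rfl]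
    · have hlt := h.lt
      obtain rfl : i = a := by omega
      obtain rfl : j = b := by omega
      rw [hv.eq_one i j le_rfl le_rfl h, hw.eq_one i j le_rfl le_rfl h]

/-- Below an arc, the determinants of a unimodular family are determined by `T`. -/
theorem IsUnimodularOn.pairDet_unique (hT : IsMaximalNonCrossing T) (h : Joins T a b)
    (hv : IsUnimodularOn T a b v) (hw : IsUnimodularOn T a b w) {i j : ℤ} (hi : a ≤ i)
    (hij : i ≤ j) (hj : j ≤ b) : pairDet v i j = pairDet w i j :=
  IsUnimodularOn.pairDet_unique_aux hT (b - a).toNat a b h (Int.self_le_toNat _) hv hw i j hi hij hj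

end Unimodular

/-! ### Gluing and the tiling -/

theorem exists_function_eq_pairDet {T : Set halfPlane} (hT : IsMaximalNonCrossing T)
    (hfin : IsLocallyFiniteArcs T) : ∃ f : ℤ → ℤ → ℤ, ∀ m n : ℤ, ∃ v,
      IsUnimodularOn T m n v ∧ ∀ i j, m ≤ i → i ≤ j → j ≤ n → f i j = pairDet v i j := by
  choose a b hab ha hb using exists_joins_cover hT hfin
  choose v hv using fun m n => (hab m n).exists_isUnimodularOn hT
  refine ⟨fun i j => pairDet (v i j) i j, fun m n => ⟨v m n, (hv m n).mono (ha m n) (hb m n), ?_⟩⟩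
  intro i j hi hij hj
  -- Two covering arcs, chosen for `(i, j)` and for `(m, n)`, are compared through a family below a
  -- third arc lying over both.
  obtain ⟨c, d, hcd, hc, hd⟩ :=
    exists_joins_cover hT hfin (min (a i j) (a m n)) (max (b i j) (b m n))
  obtain ⟨w, hw⟩ := hcd.exists_isUnimodularOn hT
  have e₁ : pairDet (v i j) i j = pairDet w i j :=
    (hv i j).pairDet_unique hT (hab i j)
      (hw.mono (hc.trans (min_le_left _ _)) ((le_max_left _ _).trans hd)) (ha i j) hij (hb i j)
  have e₂ : pairDet (v m n) i j = pairDet w i j :=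
    (hv m n).pairDet_unique hT (hab m n)
      (hw.mono (hc.trans (min_le_right _ _)) ((le_max_right _ _).trans hd))
      ((ha m n).trans hi) hij (hj.trans (hb m n))
  exact e₁.trans e₂.symm

theorem mainTheorem10 (T : Set halfPlane) (hT : IsMaximalNonCrossing T)
    (hfin : IsLocallyFiniteArcs T) :
    ∃ r : halfPlane → ℤ, IsSL2Tiling r ∧ (∀ q, 0 < r q) ∧ ∀ t ∈ T, r t = 1 := by
  obtain ⟨f, hf⟩ := exists_function_eq_pairDet hT hfin
  refine ⟨fun q => f q.1.1 q.1.2, ⟨fun i j h₁ h₂ h₃ h₄ => ?_, fun i => ?_⟩, ?_, ?_⟩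
  · rw [mem_halfPlane] at h₁ h₂ h₃ h₄
    obtain ⟨v, hv, e⟩ := hf i (j + 1)
    rw [Matrix.det_fin_two_of]
    dsimp only
    rw [e i j (by omega) (by omega) (by omega), e i (j + 1) (by omega) (by omega) (by omega),
      e (i + 1) j (by omega) (by omega) (by omega),
      -- Ptolemy for `i`, `i + 1`, `j`, `j + 1`: the product of the two edge determinants is the
      -- required `1`.
      e (i + 1) (j + 1) (by omega) (by omega) (by omega), pairDet_mul_pairDet,
      hv.eq_one i (i + 1) (by omega) (by omega) (joins_succ T i),
      hv.eq_one j (j + 1) (by omega) (by omega) (joins_succ T j)]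
    ring
  · obtain ⟨v, hv, e⟩ := hf i (i + 3)
    have h₁ := hv.eq_one i (i + 1) (by omega) (by omega) (joins_succ T i)
    have h₂ := hv.eq_one (i + 1) (i + 2) (by omega) (by omega) (Or.inl (by ring))
    have h₃ := hv.eq_one (i + 2) (i + 3) (by omega) (by omega) (Or.inl (by ring))
    rw [Matrix.det_fin_two_of]
    dsimp only
    rw [e i (i + 2) (by omega) (by omega) (by omega), e i (i + 3) (by omega) (by omega) (by omega),
      e (i + 1) (i + 3) (by omega) (by omega) (by omega), pairDet_mul_pairDet, h₁, h₂, h₃]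
    ring
  · rintro ⟨⟨m, n⟩, h⟩
    rw [mem_halfPlane] at h
    obtain ⟨v, hv, e⟩ := hf m n
    dsimp only
    rw [e m n le_rfl (by omega) le_rfl]
    exact hv.pos m n le_rfl (by omega) le_rfl
  · rintro ⟨⟨m, n⟩, h⟩ ht
    have h' := mem_halfPlane.1 h
    obtain ⟨v, hv, e⟩ := hf m n
    dsimp only
    rw [e m n le_rfl (by omega) le_rfl]
    exact hv.eq_one m n le_rfl le_rfl (Or.inr ⟨h, ht⟩)
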